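/- Let $\varepsilon\in(0,1)$ and $s=1+\varepsilon$. Let $G$ be a compact group acting continuously on $\mathbb{R}^d$ by linear isometries, with normalized Haar measure $\mu$. A template $t$ is drawn by Gaussian sampling with rejection: $t=n$ with $n\sim\mathcal N(0,\tfrac1d I_d)$ if $\|n\|_2^2<1+\varepsilon$, and $t=\perp$ otherwise. For $x\in\mathbb{R}^d$ and $\tau\in\mathbb{R}$ put $\psi(x,t,\tau)=\mu\{g\in G:\langle x,gt\rangle\le\tau\}$ if $t\neq\perp$ and $\psi(x,\perp,\tau)=0$, and define $$K_s(x,z)=\mathbb{E}_t\int_{-s}^{s}\psi(x,t,\tau)\,\psi(z,t,\tau)\,d\tau,\qquad d_G(x,z)=\frac{1}{\sqrt{2\pi d}}\int_G\int_G\|gx-g'z\|_2\,d\mu(g)\,d\mu(g').$$ For $m,n,r\ge 1$, independent templates $t_1,\dots,t_m$ and, independently of them, independent $g_1,\dots,g_r\sim\mu$, let $\Phi(x)\in\mathbb{R}^{(2n+1)\times m}$ be the random feature map with entries $$\Phi(x)_{j,k}=\frac{\sqrt{s}}{\sqrt{nm}\;r}\sum_{i=1}^{r}\mathbf 1\{\langle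 g_it_j,x\rangle\le sk/n\},\qquad 1\le j\le m,\ -n\le k\le n,$$ the entries being $0$ when $t_j=\perp$. Finally let $$\delta_1(d,\varepsilon)=\frac{e^{-d\varepsilon^2/16}}{\sqrt d}-\frac12\,\frac{e^{-\varepsilon d/2}(1+\varepsilon)^{d/2}}{\sqrt d},\qquad \delta_2(d,\varepsilon)=\frac{e^{-d\varepsilon^2/16}}{\sqrt d}+(1+\varepsilon)e^{-d\varepsilon^2/8}.$$ 1. For all unit vectors $x,z\in\mathbb{R}^d$ and every $m\ge1$, $\;\mathbb{E}_{t,g}\langle\Phi(x),\Phi(z)\rangle\to K_s(x,z)$ as $n,r\to\infty$, and $$\varepsilon-\delta_2(d,\varepsilon)\;\le\;K_s(x,z)-\bigl(1-d_G(x,z)\bigr)\;\le\;\varepsilon+\delta_1(d,\varepsilon).$$ 2. As $d\to\infty$, $\delta_1(d,\varepsilon)\to0$ and $\delta_2(d,\varepsilon)\to0$, and $K_s(x,z)-\bigl(s-d_G(x,z)\bigr)\to0$ uniformly over all such groups $G$ and all unit vectors $x,z\in\mathbb{R}^d$. 3. $K_s$ is symmetric and positive semidefinite on $\mathbb{R}^d$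 (in particular on the unit sphere), and it is group-invariant: $K_s(gx,g'z)=K_s(x,z)$ for all $g,g'\in G$ and $x,z\in\mathbb{R}^d$. -/

import Mathlib

open MeasureTheory ProbabilityTheory Filter Topology

universe u

noncomputable section

namespace CDFPool

/-- Euclidean space `ℝ^d`. -/
abbrev E (d : ℕ) := EuclideanSpace ℝ (Fin d)

/-- The Gaussian law `N(0, (1/d) I_d)` on `ℝ^d`. -/
def gaussianLaw (d : ℕ) : Measure (E d) :=
  (stdGaussian (E d)).map (fun v => (Real.sqrt d)⁻¹ • v)

open Classical in
/-- Rejection step: the draw `v` is kept as the template if `‖v‖² < 1 + ε`; otherwise the outcome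
is the rejection symbol `⊥`, which is `none` here. -/
def template {d : ℕ} (ε : ℝ) (v : E d) : Option (E d) :=
  if ‖v‖ ^ 2 < 1 + ε then some v else none

section Action

variable {d : ℕ} {G : Type u} [Group G]

/-- The truncated CDF `ψ(x, t, τ) = μ {g | ⟨x, g t⟩ ≤ τ}`. A rejected template contributes `0`. -/
def psi [MeasurableSpace G] (ρ : G →* (E d ≃ₗᵢ[ℝ] E d)) (μ : Measure G) (x : E d) :
    Option (E d) → ℝ → ℝ
  | none, _ => 0
  | some t, τ => μ.real {g : G | inner ℝ x (ρ g t) ≤ τ}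

/-- The expected kernel `K_s(x, z) = E_t ∫_{-s}^{s} ψ(x, t, τ) ψ(z, t, τ) dτ`, `s = 1 + ε`, the
template `t` being drawn by Gaussian sampling with rejection. -/
def kernel [MeasurableSpace G] (ρ : G →* (E d ≃ₗᵢ[ℝ] E d)) (μ : Measure G) (ε : ℝ)
    (x z : E d) : ℝ :=
  ∫ v, (∫ τ in (-(1 + ε))..(1 + ε),
    psi ρ μ x (template ε v) τ * psi ρ μ z (template ε v) τ) ∂(gaussianLaw d)

/-- The distance `d_G` between the orbits of `x` and `z`. -/
def orbitDist [MeasurableSpace G] (ρ : G →* (E d ≃ₗᵢ[ℝ] E d)) (μ : Measure G)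
    (x z : E d) : ℝ :=
  1 / Real.sqrt (2 * Real.pi * d) * ∫ g, ∫ g', ‖ρ g x - ρ g' z‖ ∂μ ∂μ

open Classical in
/-- `∑_i 1[⟨g_i t, x⟩ ≤ τ]` for sampled group elements `g_1, …, g_r`; it is `0` for a rejected
template. -/
def countBelow {r : ℕ} (ρ : G →* (E d ≃ₗᵢ[ℝ] E d)) (g : Fin r → G) (x : E d) :
    Option (E d) → ℝ → ℝ
  | none, _ => 0
  | some t, τ => ∑ i, if inner ℝ (ρ (g i) t) x ≤ τ then (1 : ℝ) else 0

/-- The random feature map `Φ(x) ∈ ℝ^{(2n+1) × m}` built from `r` group elements `g`, `m` templates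
`t` and bins `sk/n`, `-n ≤ k ≤ n`. -/
def featureMap {m r : ℕ} (n : ℕ) (ρ : G →* (E d ≃ₗᵢ[ℝ] E d)) (s : ℝ)
    (t : Fin m → Option (E d)) (g : Fin r → G) (x : E d) :
    EuclideanSpace ℝ (Fin m × Finset.Icc (-(n : ℤ)) (n : ℤ)) :=
  WithLp.toLp 2 fun jk =>
    Real.sqrt s / (Real.sqrt ((n : ℝ) * m) * r)
      * countBelow ρ g x (t jk.1) (s * ((jk.2 : ℤ) : ℝ) / n)

/-- `E_{t,g} ⟨Φ(x), Φ(z)⟩` with `s = 1 + ε`, for `m` independent templates (Gaussian sampling with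
rejection) and, independently, `r` independent group elements with law `μ`. -/
def expectedFeatureInner [MeasurableSpace G] (m n r : ℕ) (ρ : G →* (E d ≃ₗᵢ[ℝ] E d))
    (μ : Measure G) (ε : ℝ) (x z : E d) : ℝ :=
  ∫ w : (Fin m → E d) × (Fin r → G),
    inner ℝ (featureMap n ρ (1 + ε) (fun j => template ε (w.1 j)) w.2 x)
      (featureMap n ρ (1 + ε) (fun j => template ε (w.1 j)) w.2 z)
    ∂((Measure.pi fun _ : Fin m => gaussianLaw d).prod (Measure.pi fun _ : Fin r => μ))

end Action

/-- The upper error term `δ₁(d, ε)`. -/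
def delta1 (d : ℕ) (ε : ℝ) : ℝ :=
  Real.exp (-(d * ε ^ 2) / 16) / Real.sqrt d
    - 1 / 2 * (Real.exp (-(ε * d) / 2) * (1 + ε) ^ ((d : ℝ) / 2) / Real.sqrt d)

/-- The lower error term `δ₂(d, ε)`. -/
def delta2 (d : ℕ) (ε : ℝ) : ℝ :=
  Real.exp (-(d * ε ^ 2) / 16) / Real.sqrt d + (1 + ε) * Real.exp (-(d * ε ^ 2) / 8)

end CDFPool

end

/-! Write `s = 1 + ε`. For an accepted template `t` and unit `x`, every value `⟨x, g t⟩` lies in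
`(-s, s)`. The product of the two CDFs is the CDF of the maximum of `⟨x, g t⟩` and `⟨z, g' t⟩` with
`g, g'` independent, so the integral over thresholds equals `s` minus the mean of that maximum
(`intervalIntegral_psi_mul_psi`). Moving the group onto `x` and `z` and swapping integrals leaves,
for fixed `a = g⁻¹x` and `b = g'⁻¹z`, a Gaussian integral of `s - max ⟨a, v⟩ ⟨b, v⟩` over accepted
draws. Use `max = (sum + |difference|) / 2`: the sum is odd and integrates to zero, while `|⟨a - b,
v⟩|` has full Gaussian mean `‖a - b‖ √(2/(πd))`, half of which is the integrand of `d_G`. With `P`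
the rejection probability, the kernel is therefore exactly `s(1 - P) - d_G` plus half the average of
`|⟨a - b, v⟩|` over rejected draws (`setIntegral_sub_max_inner`). Cauchy–Schwarz puts this last term
in `[0, √P/√d]`, and a chi-square Chernoff bound controls `P`. The features approximate the kernel
with two separate errors: `O(1/r)` from pairs reusing the same group sample, and `O(1/n)` from a
Riemann sum of a monotone function. Positivity holds because the kernel is a Gram kernel in `L²`,
and invariance is that of Haar measure. -/

namespace CDFPool

/-! ### Unimodularity of compact groups -/

section Haar

variable {G : Type u} [Group G] [TopologicalSpace G] [IsTopologicalGroup G] [CompactSpace G]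
  [MeasurableSpace G] [BorelSpace G]

/-- A right translate of `μ` is still left-invariant, so by uniqueness it is a multiple of `μ`;
equal total mass forces the factor to be 1. -/
theorem isMulRightInvariant_of_compactSpace (μ : Measure G) [μ.IsHaarMeasure]
    [IsProbabilityMeasure μ] : μ.IsMulRightInvariant := by
  refine ⟨fun h => ?_⟩
  have hm : Measurable (fun g : G => g * h) := (continuous_mul_const h).measurable
  have : IsProbabilityMeasure (μ.map (· * h)) := Measure.isProbabilityMeasure_map hm.aemeasurable
  have e := Measure.isMulInvariant_eq_smul_of_compactSpace (μ.map (· * h)) μ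
  have e1 := congrArg (fun ν : Measure G => ν Set.univ) e
  simp only [measure_univ, Measure.smul_apply] at e1
  rw [e]
  ext s _
  rw [Measure.smul_apply]
  rw [ENNReal.smul_def, smul_eq_mul, mul_one] at e1
  rw [ENNReal.smul_def, ← e1, one_smul]

/-- Right invariance of `μ` makes `μ.inv` left-invariant, and the same mass comparison applies. -/
theorem isInvInvariant_of_compactSpace (μ : Measure G) [μ.IsHaarMeasure]
    [IsProbabilityMeasure μ] : μ.IsInvInvariant := by
  have := isMulRightInvariant_of_compactSpace μ
  refine ⟨?_⟩
  have : IsProbabilityMeasure μ.inv := Measure.isProbabilityMeasure_map measurable_inv.aemeasurable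
  have e := Measure.isMulInvariant_eq_smul_of_compactSpace μ.inv μ
  have e1 := congrArg (fun ν : Measure G => ν Set.univ) e
  simp only [measure_univ, Measure.smul_apply] at e1
  rw [e]
  ext s _
  rw [Measure.smul_apply]
  rw [ENNReal.smul_def, smul_eq_mul, mul_one] at e1
  rw [ENNReal.smul_def, ← e1, one_smul]

end Haar

/-! ### Gaussian moments and the rejection probability -/

section Gaussian

theorem integral_abs_gaussianReal : ∫ y, |y| ∂(gaussianReal 0 1) = √(2 / Real.pi) := by
  rw [integral_gaussianReal_eq_integral_smul one_ne_zero]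
  have h : ∀ y : ℝ, gaussianPDFReal 0 1 y • |y|
      = (fun t => (√(2 * Real.pi))⁻¹ * (t ^ (1 : ℝ) * Real.exp (-(1 / 2) * t ^ (2 : ℝ)))) |y| := by
    intro y
    simp only [gaussianPDFReal, smul_eq_mul, Real.rpow_one, Real.rpow_two, sq_abs, sub_zero,
      NNReal.coe_one, mul_one]
    rw [show -y ^ 2 / 2 = -(1 / 2) * y ^ 2 by ring]
    ring
  rw [integral_congr_ae (ae_of_all _ h), integral_comp_abs (f := fun t : ℝ =>
    (√(2 * Real.pi))⁻¹ * (t ^ (1 : ℝ) * Real.exp (-(1 / 2) * t ^ (2 : ℝ)))), integral_const_mul,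
    integral_rpow_mul_exp_neg_mul_rpow (by norm_num) (by norm_num) (by norm_num)]
  norm_num [Real.rpow_neg_one]
  have h2 : √2 * √2 = (2 : ℝ) := Real.mul_self_sqrt (by norm_num)
  field_simp
  rw [sq, h2]

/-- The tilted density is again Gaussian, with precision `1 - 2c`. This is the moment generating
function needed for the chi-square tail. -/
theorem integral_exp_mul_sq_gaussianReal {c : ℝ} (hc : c < 1 / 2) :
    Integrable (fun y => Real.exp (c * y ^ 2)) (gaussianReal 0 1) ∧
      ∫ y, Real.exp (c * y ^ 2) ∂(gaussianReal 0 1) = (√(1 - 2 * c))⁻¹ := by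
  have h : ∀ y : ℝ, gaussianPDFReal 0 1 y • Real.exp (c * y ^ 2)
      = (√(2 * Real.pi))⁻¹ * Real.exp (-(1 / 2 - c) * y ^ 2) := by
    intro y
    simp only [gaussianPDFReal, smul_eq_mul, sub_zero, NNReal.coe_one, mul_one]
    rw [mul_assoc, ← Real.exp_add]
    congr 2
    ring
  constructor
  · rw [gaussianReal_of_var_ne_zero _ one_ne_zero, integrable_withDensity_iff_integrable_smul'
      (measurable_gaussianPDF _ _) (by simp [gaussianPDF])]
    simp_rw [toReal_gaussianPDF, h]
    exact (integrable_exp_neg_mul_sq (by linarith)).const_mul _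
  · rw [integral_gaussianReal_eq_integral_smul one_ne_zero]
    simp_rw [h]
    rw [integral_const_mul, integral_gaussian, ← Real.sqrt_inv, ← Real.sqrt_inv,
      ← Real.sqrt_mul (by positivity)]
    congr 1
    have : 1 - 2 * c ≠ 0 := by linarith
    have : 1 / 2 - c ≠ 0 := by linarith
    field_simp

instance (d : ℕ) : IsProbabilityMeasure (gaussianLaw d) :=
  Measure.isProbabilityMeasure_map (Measurable.aemeasurable (by fun_prop))

/-- Both sides are `N(0, ‖w‖²/d)`; the right-hand form reduces moments of `⟨w, v⟩` to those of a
standard normal by scaling. -/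
theorem gaussianLaw_map_inner {d : ℕ} (w : E d) :
    (gaussianLaw d).map (fun v => inner ℝ w v)
      = (gaussianReal 0 1).map (fun y => (‖w‖ * (√d)⁻¹) * y) := by
  have h1 : (stdGaussian (E d)).map (fun v => inner ℝ w v) = gaussianReal 0 (‖w‖ ^ 2).toNNReal := by
    have := IsGaussian.map_eq_gaussianReal (μ := stdGaussian (E d)) (innerSL ℝ w)
    rw [integral_strongDual_stdGaussian, variance_dual_stdGaussian, innerSL_apply_norm] at this
    exact this
  rw [gaussianLaw, Measure.map_map (by fun_prop) (by fun_prop)]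
  have h2 : ((fun v => inner ℝ w v) ∘ fun v : E d => (√(d : ℝ))⁻¹ • v)
      = (fun y => (√(d : ℝ))⁻¹ * y) ∘ (fun v => inner ℝ w v) := by
    ext v; simp [inner_smul_right]
  rw [h2, ← Measure.map_map (by fun_prop) (by fun_prop), h1, gaussianReal_map_const_mul,
    gaussianReal_map_const_mul]
  congr 1
  · simp
  · ext
    simp [Real.toNNReal_of_nonneg, mul_pow, mul_comm]

theorem integrable_inner_gaussianLaw {d : ℕ} (w : E d) :
    Integrable (fun v => inner ℝ w v) (gaussianLaw d) := by
  have : Integrable (fun y : ℝ => y) ((gaussianLaw d).map (fun v => inner ℝ w v)) := by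
    rw [gaussianLaw_map_inner, integrable_map_measure (by fun_prop) (by fun_prop)]
    exact (IsGaussian.integrable_id (μ := gaussianReal 0 1)).const_mul _
  exact (integrable_map_measure (f := fun v => inner ℝ w v) (g := fun y : ℝ => y) (by fun_prop)
    (by fun_prop)).1 this

theorem integral_abs_inner_gaussianLaw {d : ℕ} (w : E d) :
    ∫ v, |inner ℝ w v| ∂(gaussianLaw d) = ‖w‖ * √(2 / (Real.pi * d)) := by
  have : ∫ v, |inner ℝ w v| ∂(gaussianLaw d)
      = ∫ y, |y| ∂((gaussianLaw d).map (fun v => inner ℝ w v)) :=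
    (integral_map (f := fun y => |y|) (φ := fun v => inner ℝ w v) (by fun_prop) (by fun_prop)).symm
  rw [this, gaussianLaw_map_inner, integral_map (by fun_prop) (by fun_prop)]
  simp_rw [abs_mul]
  rw [integral_const_mul, integral_abs_gaussianReal, abs_of_nonneg (by positivity),
    abs_of_nonneg (by positivity), mul_assoc, ← Real.sqrt_inv, ← Real.sqrt_mul (by positivity)]
  congr 2
  field_simp

theorem integrable_inner_sq_gaussianLaw {d : ℕ} (w : E d) :
    Integrable (fun v => inner ℝ w v ^ 2) (gaussianLaw d) := by
  have : Integrable (fun y : ℝ => y ^ 2) ((gaussianLaw d).map (fun v => inner ℝ w v)) := by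
    rw [gaussianLaw_map_inner, integrable_map_measure (by fun_prop) (by fun_prop)]
    have := (memLp_id_gaussianReal (μ := 0) (v := 1) 2).integrable_sq.const_mul
      ((‖w‖ * (√(d : ℝ))⁻¹) ^ 2)
    simpa [Function.comp_def, mul_pow] using this
  exact (integrable_map_measure (f := fun v => inner ℝ w v) (g := fun y : ℝ => y ^ 2)
    (by fun_prop) (by fun_prop)).1 this

theorem integral_inner_sq_gaussianLaw {d : ℕ} (w : E d) :
    ∫ v, inner ℝ w v ^ 2 ∂(gaussianLaw d) = ‖w‖ ^ 2 / d := by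
  have : ∫ v, inner ℝ w v ^ 2 ∂(gaussianLaw d)
      = ∫ y, y ^ 2 ∂((gaussianLaw d).map (fun v => inner ℝ w v)) :=
    (integral_map (f := fun y => y ^ 2) (φ := fun v => inner ℝ w v) (by fun_prop) (by fun_prop)).symm
  rw [this, gaussianLaw_map_inner, integral_map (by fun_prop) (by fun_prop)]
  simp_rw [mul_pow]
  have hv : ∫ y : ℝ, y ^ 2 ∂(gaussianReal 0 1) = 1 := by
    have := variance_of_integral_eq_zero (μ := gaussianReal 0 1) (X := id) (by fun_prop)
      (by simp)
    simp at this
    exact this.symm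
  rw [integral_const_mul, hv, inv_pow, Real.sq_sqrt (by positivity)]
  ring

theorem gaussianLaw_map_neg (d : ℕ) : (gaussianLaw d).map (fun v => -v) = gaussianLaw d := by
  have h := stdGaussian_map (LinearIsometryEquiv.neg ℝ (E := E d))
  rw [gaussianLaw, Measure.map_map (by fun_prop) (by fun_prop)]
  conv_rhs => rw [← h]
  rw [Measure.map_map (by fun_prop) (by fun_prop)]
  congr 1
  ext v
  simp

theorem integral_eq_zero_of_odd_gaussianLaw {d : ℕ} {f : E d → ℝ} (hf : ∀ v, f (-v) = - f v) :
    ∫ v, f v ∂(gaussianLaw d) = 0 := by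
  have h1 : ∫ v, f v ∂(gaussianLaw d) = ∫ v, f (-v) ∂(gaussianLaw d) := by
    conv_lhs => rw [← gaussianLaw_map_neg]
    -- Negation is a measurable equivalence, so `f` needs neither measurability nor integrability.
    exact integral_map_equiv (MeasurableEquiv.neg (E d)) f
  simp_rw [hf, integral_neg] at h1
  linarith

/-- The Chernoff bound for the rejection probability. -/
noncomputable def chernoff (d : ℕ) (ε : ℝ) : ℝ := Real.exp (-(ε * d) / 2) * (1 + ε) ^ ((d : ℝ) / 2)

/-- The event that the draw is rejected. -/
def rejected (d : ℕ) (ε : ℝ) : Set (E d) := {v | 1 + ε ≤ ‖v‖ ^ 2}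

theorem measurableSet_rejected (d : ℕ) (ε : ℝ) : MeasurableSet (rejected d ε) :=
  measurableSet_le (by fun_prop) (by fun_prop)

theorem gaussianLaw_rejected_le {d : ℕ} (hd : d ≠ 0) {ε : ℝ} (hε : 0 < ε) :
    (gaussianLaw d).real (rejected d ε) ≤ chernoff d ε := by
  have hd' : (0 : ℝ) < d := by positivity
  -- The minimiser of `exp (-c d (1 + ε)) (1 - 2c)^(-d/2)`, characterised by `1 - 2c = 1/(1 + ε)`.
  set c : ℝ := ε / (2 * (1 + ε)) with hc
  have hc0 : 0 ≤ c := by positivity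
  have hc1 : c < 1 / 2 := by
    rw [hc, div_lt_div_iff₀ (by positivity) (by positivity)]; linarith
  obtain ⟨hi, he⟩ := integral_exp_mul_sq_gaussianReal hc1
  have hset : (gaussianLaw d).real (rejected d ε)
      = (Measure.pi (fun _ : Fin d => gaussianReal 0 1)).real
        {x | d * (1 + ε) ≤ ∑ i, x i ^ 2} := by
    rw [gaussianLaw, map_measureReal_apply (by fun_prop) (measurableSet_rejected d ε),
      ← map_pi_eq_stdGaussian, map_measureReal_apply (by fun_prop)
        (measurableSet_rejected d ε |>.preimage (by fun_prop))]
    congr 1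
    ext x
    simp only [rejected, Set.mem_preimage, Set.mem_ofPred_eq, EuclideanSpace.real_norm_sq_eq,
      PiLp.smul_apply, smul_eq_mul, mul_pow, inv_pow, ← Finset.mul_sum]
    rw [Real.sq_sqrt hd'.le, ← div_eq_inv_mul, le_div_iff₀ hd', mul_comm]
  have hexp : ∀ x : Fin d → ℝ, Real.exp (c * ∑ i, x i ^ 2) = ∏ i, Real.exp (c * x i ^ 2) := by
    intro x; rw [Finset.mul_sum, Real.exp_sum]
  have key := measure_ge_le_exp_mul_mgf (μ := Measure.pi (fun _ : Fin d => gaussianReal 0 1))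
    (X := fun x => ∑ i, x i ^ 2) (d * (1 + ε)) hc0 (by
      simp_rw [hexp]
      exact Integrable.fintype_prod (f := fun _ y => Real.exp (c * y ^ 2)) (fun _ => hi))
  rw [hset]
  refine key.trans (le_of_eq ?_)
  rw [mgf]
  simp_rw [hexp]
  rw [integral_fintype_prod_eq_pow (E := ℝ) (fun y => Real.exp (c * y ^ 2)), he, chernoff,
    Fintype.card_fin]
  have h1 : 1 - 2 * c = (1 + ε)⁻¹ := by rw [hc]; field_simp; ring
  have h2 : -c * (d * (1 + ε)) = -(ε * d) / 2 := by rw [hc]; field_simp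
  rw [h1, h2, Real.sqrt_inv, inv_inv, Real.sqrt_eq_rpow, ← Real.rpow_natCast, ← Real.rpow_mul
    (by positivity)]
  congr 2
  ring

/-- With `u = ε - ε²/4`, the bound `1 + u + u²/2 ≤ exp u` leaves the surplus `ε²(1 - ε)/4 + ε⁴/32`.
Raised to the power `d/2`, it cancels the linear exponent in the Chernoff bound and leaves `-dε²/8`.
-/
theorem one_add_le_exp_sub_sq {ε : ℝ} (h0 : 0 ≤ ε) (h1 : ε ≤ 1) :
    1 + ε ≤ Real.exp (ε - ε ^ 2 / 4) := by
  have h := Real.quadratic_le_exp_of_nonneg (x := ε - ε ^ 2 / 4) (by nlinarith)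
  refine le_trans ?_ h
  nlinarith [mul_nonneg (sq_nonneg ε) (sub_nonneg.2 h1), sq_nonneg ε,
    mul_nonneg (sq_nonneg ε) (sq_nonneg ε)]

theorem chernoff_pos {ε : ℝ} (d : ℕ) (h0 : 0 ≤ ε) : 0 < chernoff d ε := by
  unfold chernoff; positivity

theorem chernoff_le {ε : ℝ} (d : ℕ) (h0 : 0 ≤ ε) (h1 : ε ≤ 1) :
    chernoff d ε ≤ Real.exp (-(d * ε ^ 2) / 8) := by
  have h := Real.rpow_le_rpow (by positivity) (one_add_le_exp_sub_sq h0 h1)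
    (show (0 : ℝ) ≤ d / 2 by positivity)
  rw [← Real.exp_mul] at h
  refine (mul_le_mul_of_nonneg_left h (Real.exp_pos _).le).trans (le_of_eq ?_)
  rw [← Real.exp_add]
  congr 1
  ring

theorem chernoff_le_one {ε : ℝ} (d : ℕ) (h0 : 0 ≤ ε) (h1 : ε ≤ 1) : chernoff d ε ≤ 1 := by
  refine (chernoff_le d h0 h1).trans (Real.exp_le_one_iff.2 ?_)
  have : (0 : ℝ) ≤ d * ε ^ 2 := by positivity
  linarith

theorem sqrt_chernoff_le {ε : ℝ} (d : ℕ) (h0 : 0 ≤ ε) (h1 : ε ≤ 1) :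
    √(chernoff d ε) ≤ Real.exp (-(d * ε ^ 2) / 16) := by
  refine Real.sqrt_le_iff.2 ⟨by positivity, (chernoff_le d h0 h1).trans (le_of_eq ?_)⟩
  rw [← Real.exp_nat_mul]
  congr 1
  push_cast
  ring

/-- The contribution of the rejected draws to the mean of `|⟨w, v⟩|`. -/
theorem setIntegral_abs_inner_gaussianLaw_le {d : ℕ} (w : E d) {s : Set (E d)}
    (hs : MeasurableSet s) :
    ∫ v in s, |inner ℝ w v| ∂(gaussianLaw d) ≤ ‖w‖ / √d * √((gaussianLaw d).real s) := by
  have hL : MemLp (fun v : E d => |inner ℝ w v|) (ENNReal.ofReal 2) (gaussianLaw d) := by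
    rw [show ENNReal.ofReal 2 = 2 by simp]
    rw [memLp_two_iff_integrable_sq (by fun_prop)]
    simpa using integrable_inner_sq_gaussianLaw w
  have hI : MemLp (s.indicator (fun _ => (1 : ℝ))) (ENNReal.ofReal 2) (gaussianLaw d) :=
    (memLp_const 1).indicator hs
  -- Cauchy–Schwarz against the indicator of `s`; the second moment of `⟨w, v⟩` is `‖w‖²/d`.
  have h := integral_mul_le_Lp_mul_Lq_of_nonneg (μ := gaussianLaw d) (p := 2) (q := 2)
    Real.HolderConjugate.two_two (ae_of_all _ fun v => abs_nonneg (inner ℝ w v))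
    (ae_of_all _ fun v => Set.indicator_nonneg (fun _ _ => zero_le_one) v) hL hI
  have e1 : ∀ v : E d, |inner ℝ w v| * s.indicator (fun _ => (1 : ℝ)) v
      = s.indicator (fun v => |inner ℝ w v|) v := by
    intro v; by_cases hv : v ∈ s <;> simp [hv]
  have e2 : ∀ v : E d, s.indicator (fun _ => (1 : ℝ)) v ^ (2 : ℝ) = s.indicator 1 v := by
    intro v; by_cases hv : v ∈ s <;> simp [hv]
  simp_rw [e1, e2, integral_indicator_one hs, integral_indicator hs, Real.rpow_two, sq_abs,
    integral_inner_sq_gaussianLaw, ← Real.sqrt_eq_rpow] at h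
  rwa [Real.sqrt_div (by positivity), Real.sqrt_sq (norm_nonneg _)] at h

end Gaussian

/-! ### The kernel as an average of `s - max` -/

section Action

variable {d : ℕ} {G : Type u} [Group G]

theorem inner_action (ρ : G →* (E d ≃ₗᵢ[ℝ] E d)) (g : G) (x v : E d) :
    inner ℝ x (ρ g v) = inner ℝ (ρ g⁻¹ x) v := by
  rw [← LinearIsometryEquiv.inner_map_map (ρ g) (ρ g⁻¹ x) v, map_inv]
  simp

theorem template_of_lt {ε : ℝ} {v : E d} (h : ‖v‖ ^ 2 < 1 + ε) : template ε v = some v :=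
  if_pos h

theorem template_of_not_lt {ε : ℝ} {v : E d} (h : ¬ ‖v‖ ^ 2 < 1 + ε) : template ε v = none :=
  if_neg h

section Psi

variable [MeasurableSpace G]

theorem psi_nonneg (ρ : G →* (E d ≃ₗᵢ[ℝ] E d)) (μ : Measure G) (x : E d) (t : Option (E d))
    (τ : ℝ) : 0 ≤ psi ρ μ x t τ := by
  cases t
  · exact le_rfl
  · exact measureReal_nonneg

theorem psi_le_one (ρ : G →* (E d ≃ₗᵢ[ℝ] E d)) (μ : Measure G) [IsProbabilityMeasure μ] (x : E d)
    (t : Option (E d)) (τ : ℝ) : psi ρ μ x t τ ≤ 1 := by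
  cases t
  · exact zero_le_one
  · exact measureReal_le_one

theorem psi_monotone (ρ : G →* (E d ≃ₗᵢ[ℝ] E d)) (μ : Measure G) [IsProbabilityMeasure μ] (x : E d)
    (t : Option (E d)) : Monotone (psi ρ μ x t) := by
  intro a b hab
  cases t
  · exact le_rfl
  · exact measureReal_mono fun g (hg : _ ≤ a) => hg.trans hab

end Psi

/-- Since `‖t‖² < 1 + ε ≤ (1 + ε)²`, the threshold window `[-s, s]` contains the whole range of the
CDF. -/
theorem abs_inner_action_lt {ρ : G →* (E d ≃ₗᵢ[ℝ] E d)} {ε : ℝ} (hε : 0 < ε) (g : G) {x t : E d}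
    (hx : ‖x‖ = 1) (ht : ‖t‖ ^ 2 < 1 + ε) : |inner ℝ x (ρ g t)| < 1 + ε := by
  have h := abs_real_inner_le_norm x (ρ g t)
  rw [hx, one_mul, LinearIsometryEquiv.norm_map] at h
  nlinarith [norm_nonneg t]

variable [TopologicalSpace G] [MeasurableSpace G] [BorelSpace G] {ρ : G →* (E d ≃ₗᵢ[ℝ] E d)}

theorem measurable_action_left (hρ : Continuous (fun p : G × E d => ρ p.1 p.2)) (x : E d) :
    Measurable (fun g : G => ρ g x) :=
  (hρ.comp (by fun_prop : Continuous fun g : G => (g, x))).measurable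

/-- Linearity in the template splits the function into coordinates of `f` times functions of the
group element alone. -/
theorem measurable_inner_action (hρ : Continuous (fun p : G × E d => ρ p.1 p.2)) (x : E d)
    {α : Type*} [MeasurableSpace α] {f : α → E d} {h : α → G} (hf : Measurable f)
    (hh : Measurable h) : Measurable (fun a => inner ℝ x (ρ (h a) (f a))) := by
  have e : ∀ a, inner ℝ x (ρ (h a) (f a))
      = ∑ i, f a i * inner ℝ x (ρ (h a) (EuclideanSpace.basisFun (Fin d) ℝ i)) := by
    intro a
    conv_lhs => rw [← (EuclideanSpace.basisFun (Fin d) ℝ).sum_repr (f a)]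
    simp only [map_sum, inner_sum, map_smul, inner_smul_right, EuclideanSpace.basisFun_repr]
  simp_rw [e]
  refine Finset.measurable_sum _ fun i _ => Measurable.mul (by fun_prop) ?_
  have hc : Measurable fun g : G => inner ℝ x (ρ g (EuclideanSpace.basisFun (Fin d) ℝ i)) :=
    (measurable_const (a := x)).inner (measurable_action_left hρ _)
  exact hc.comp hh

theorem measurable_psi (hρ : Continuous (fun p : G × E d => ρ p.1 p.2)) (μ : Measure G)
    [IsProbabilityMeasure μ] (ε : ℝ) (x : E d) :
    Measurable (fun q : E d × ℝ => psi ρ μ x (template ε q.1) q.2) := by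
  classical
  have h : (fun q : E d × ℝ => psi ρ μ x (template ε q.1) q.2) = fun q =>
      if ‖q.1‖ ^ 2 < 1 + ε then μ.real {g : G | inner ℝ x (ρ g q.1) ≤ q.2} else 0 := by
    ext q
    split_ifs with hq
    · rw [template_of_lt hq]; rfl
    · rw [template_of_not_lt hq]; rfl
  rw [h]
  refine Measurable.ite (measurableSet_lt (by fun_prop) (by fun_prop)) ?_ measurable_const
  have hs : MeasurableSet {r : (E d × ℝ) × G | inner ℝ x (ρ r.2 r.1.1) ≤ r.1.2} :=
    measurableSet_le (measurable_inner_action hρ x (by fun_prop) measurable_snd) (by fun_prop)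
  exact (measurable_measure_prodMk_left hs).ennreal_toReal

theorem intervalIntegral_ite_le {s M : ℝ} (h1 : -s < M) (h2 : M ≤ s) :
    ∫ τ in (-s)..s, (if M ≤ τ then (1 : ℝ) else 0) = s - M := by
  rw [intervalIntegral.integral_of_le (by linarith)]
  have : (fun τ : ℝ => if M ≤ τ then (1 : ℝ) else 0) = (Set.Ici M).indicator 1 := by
    ext τ; simp [Set.indicator_apply]
  rw [this, integral_indicator_one measurableSet_Ici, measureReal_restrict_apply measurableSet_Ici]
  -- The strict inequality `-s < M` keeps the endpoint `M` inside the half-open interval.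
  have : Set.Ici M ∩ Set.Ioc (-s) s = Set.Icc M s := by
    ext τ
    simp only [Set.mem_inter_iff, Set.mem_Ici, Set.mem_Ioc, Set.mem_Icc]
    constructor
    · rintro ⟨a, _, c⟩; exact ⟨a, c⟩
    · rintro ⟨a, c⟩; exact ⟨a, by linarith, c⟩
  rw [this, Real.volume_real_Icc_of_le h2]

/-- A product of CDFs is the CDF of the maximum of independent copies; Fubini then integrates `1[M ≤
τ]` over the window, giving `s - M`. -/
theorem intervalIntegral_psi_mul_psi (hρ : Continuous (fun p : G × E d => ρ p.1 p.2))
    (μ : Measure G) [IsProbabilityMeasure μ] {ε : ℝ} (hε : 0 < ε) {x z t : E d}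
    (hx : ‖x‖ = 1) (hz : ‖z‖ = 1) (ht : ‖t‖ ^ 2 < 1 + ε) :
    ∫ τ in (-(1 + ε))..(1 + ε), psi ρ μ x (some t) τ * psi ρ μ z (some t) τ
      = ∫ p, ((1 + ε) - max (inner ℝ x (ρ p.1 t)) (inner ℝ z (ρ p.2 t))) ∂(μ.prod μ) := by
  classical
  set M : G × G → ℝ := fun p => max (inner ℝ x (ρ p.1 t)) (inner ℝ z (ρ p.2 t)) with hM
  have hMm : Measurable M :=
    (measurable_inner_action hρ x measurable_const measurable_fst).max
      (measurable_inner_action hρ z measurable_const measurable_snd)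
  have h1 : ∀ τ, psi ρ μ x (some t) τ * psi ρ μ z (some t) τ
      = ∫ p, (if M p ≤ τ then (1 : ℝ) else 0) ∂(μ.prod μ) := by
    intro τ
    have : (fun p => if M p ≤ τ then (1 : ℝ) else 0)
        = ({g : G | inner ℝ x (ρ g t) ≤ τ} ×ˢ {g : G | inner ℝ z (ρ g t) ≤ τ}).indicator 1 := by
      ext p
      simp [Set.indicator_apply, hM]
    rw [this, integral_indicator_one, measureReal_prod_prod]
    · rfl
    · exact (measurableSet_le (measurable_inner_action hρ x measurable_const measurable_id)
        measurable_const).prod (measurableSet_le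
          (measurable_inner_action hρ z measurable_const measurable_id) measurable_const)
  simp_rw [h1]
  rw [intervalIntegral.integral_of_le (by linarith), integral_integral_swap]
  · refine integral_congr_ae (ae_of_all _ fun p => ?_)
    have hp : |M p| < 1 + ε := by
      have a := abs_lt.1 (abs_inner_action_lt (ρ := ρ) hε p.1 hx ht)
      have b := abs_lt.1 (abs_inner_action_lt (ρ := ρ) hε p.2 hz ht)
      exact abs_lt.2 ⟨lt_max_of_lt_left a.1, max_lt a.2 b.2⟩
    have hp' := abs_lt.1 hp
    simp only
    rw [← intervalIntegral.integral_of_le (by linarith), intervalIntegral_ite_le hp'.1 hp'.2.le]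
  · refine Integrable.of_bound (C := 1) (Measurable.aestronglyMeasurable ?_)
      (ae_of_all _ fun q => ?_)
    · exact Measurable.ite (measurableSet_le (hMm.comp measurable_snd) measurable_fst)
        measurable_const measurable_const
    · simp only [Function.uncurry]
      split_ifs <;> simp

/-- Fubini exchanges template and group; the integrand is bounded by `2s` because rejected draws are
cut out. The inverses come from moving the action off the template, so that the inner Gaussian
integral has fixed vectors. -/
theorem kernel_eq_integral_prod (hρ : Continuous (fun p : G × E d => ρ p.1 p.2))
    (μ : Measure G) [IsProbabilityMeasure μ] {ε : ℝ} (hε : 0 < ε) {x z : E d}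
    (hx : ‖x‖ = 1) (hz : ‖z‖ = 1) :
    let F : G × G → ℝ := fun p => ∫ v in (rejected d ε)ᶜ,
      ((1 + ε) - max (inner ℝ (ρ p.1⁻¹ x) v) (inner ℝ (ρ p.2⁻¹ z) v)) ∂(gaussianLaw d)
    Integrable F (μ.prod μ) ∧ kernel ρ μ ε x z = ∫ p, F p ∂(μ.prod μ) := by
  intro F
  set H : E d → G × G → ℝ := fun v p => (rejected d ε)ᶜ.indicator
    (fun v => (1 + ε) - max (inner ℝ x (ρ p.1 v)) (inner ℝ z (ρ p.2 v))) v with hH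
  have hF : F = fun p => ∫ v, H v p ∂(gaussianLaw d) := by
    ext p
    simp only [F, hH, ← inner_action]
    rw [integral_indicator (measurableSet_rejected d ε).compl]
  have hm : Measurable (Function.uncurry H) := by
    have : Function.uncurry H = ((fun q : E d × (G × G) => q.1) ⁻¹' (rejected d ε)ᶜ).indicator
        (fun q => (1 + ε) - max (inner ℝ x (ρ q.2.1 q.1)) (inner ℝ z (ρ q.2.2 q.1))) := by
      rfl
    rw [this]
    refine Measurable.indicator ?_ (measurable_fst (measurableSet_rejected d ε).compl)
    exact measurable_const.sub
      ((measurable_inner_action hρ x measurable_fst (measurable_fst.comp measurable_snd)).max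
        (measurable_inner_action hρ z measurable_fst (measurable_snd.comp measurable_snd)))
  have hi : Integrable (Function.uncurry H) ((gaussianLaw d).prod (μ.prod μ)) := by
    refine Integrable.of_bound (C := 2 * (1 + ε)) hm.aestronglyMeasurable
      (ae_of_all _ fun q => ?_)
    simp only [Function.uncurry, hH]
    by_cases hq : q.1 ∈ rejected d ε
    · simp [hq]; linarith
    · rw [Set.indicator_of_mem (by exact hq)]
      have hq' : ‖q.1‖ ^ 2 < 1 + ε := not_le.1 hq
      have a := abs_lt.1 (abs_inner_action_lt (ρ := ρ) hε q.2.1 hx hq')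
      have b := abs_lt.1 (abs_inner_action_lt (ρ := ρ) hε q.2.2 hz hq')
      have c := max_lt a.2 b.2
      have e := a.1.trans_le (le_max_left _ (inner ℝ z (ρ q.2.2 q.1)))
      rw [Real.norm_eq_abs, abs_le]
      constructor <;> linarith
  rw [hF]
  refine ⟨hi.integral_prod_right, ?_⟩
  rw [← integral_integral_swap hi, kernel]
  refine integral_congr_ae (ae_of_all _ fun v => ?_)
  simp only [hH]
  by_cases hv : v ∈ rejected d ε
  · rw [template_of_not_lt (not_lt.2 hv)]
    simp [psi, hv]
  · have hv' : ‖v‖ ^ 2 < 1 + ε := not_le.1 hv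
    rw [template_of_lt hv', intervalIntegral_psi_mul_psi hρ μ hε hx hz hv']
    simp [hv]

end Action

/-- The mean of `s - max ⟨a, v⟩ ⟨b, v⟩` over the accepted draws. -/
theorem setIntegral_sub_max_inner {d : ℕ} (ε : ℝ) (a b : E d) :
    ∫ v in (rejected d ε)ᶜ, ((1 + ε) - max (inner ℝ a v) (inner ℝ b v)) ∂(gaussianLaw d)
      = (1 + ε) - (1 + ε) * (gaussianLaw d).real (rejected d ε)
        - 1 / √(2 * Real.pi * d) * ‖a - b‖
        + 1 / 2 * ∫ v in rejected d ε, |inner ℝ (a - b) v| ∂(gaussianLaw d) := by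
  have hmax : ∀ v : E d, (1 + ε) - max (inner ℝ a v) (inner ℝ b v)
      = (1 + ε) - 1 / 2 * inner ℝ (a + b) v - 1 / 2 * |inner ℝ (a - b) v| := by
    intro v
    rw [inner_add_left, inner_sub_left]
    rcases le_total (inner ℝ a v) (inner ℝ b v) with h | h
    · rw [max_eq_right h, abs_of_nonpos (sub_nonpos.2 h)]
      ring
    · rw [max_eq_left h, abs_of_nonneg (sub_nonneg.2 h)]
      ring
  simp_rw [hmax]
  have i1 := integrable_inner_gaussianLaw (a + b)
  have i2 := (integrable_inner_gaussianLaw (a - b)).abs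
  have hR := measurableSet_rejected d ε
  rw [integral_sub (f := fun v : E d => (1 + ε) - 1 / 2 * inner ℝ (a + b) v)
      (g := fun v : E d => 1 / 2 * |inner ℝ (a - b) v|)
      ((integrable_const _).sub (i1.const_mul _).integrableOn) (i2.const_mul _).integrableOn,
    integral_sub (integrable_const _) (i1.const_mul _).integrableOn, integral_const_mul,
    integral_const_mul]
  -- Acceptance depends only on the norm, so the truncated linear functional remains odd.
  have o : ∫ v in (rejected d ε)ᶜ, inner ℝ (a + b) v ∂(gaussianLaw d) = 0 := by
    rw [← integral_indicator hR.compl]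
    refine integral_eq_zero_of_odd_gaussianLaw fun v => ?_
    by_cases hv : v ∈ rejected d ε
    · have : -v ∈ rejected d ε := by simpa [rejected] using hv
      simp [hv, this]
    · have : -v ∉ rejected d ε := by simpa [rejected] using hv
      simp [hv, this]
  -- The accepted part of the mean of `|⟨a - b, v⟩|` is the explicit full mean minus the rejected
  -- part.
  have c := integral_add_compl hR i2
  rw [integral_abs_inner_gaussianLaw] at c
  have hs : 1 / √(2 * Real.pi * d) = 1 / 2 * √(2 / (Real.pi * d)) := by
    have h4 : (4 : ℝ) = 2 ^ 2 := by norm_num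
    rw [show 2 * Real.pi * (d : ℝ) = 4 * ((Real.pi * d) / 2) by ring, Real.sqrt_mul (by norm_num),
      h4, Real.sqrt_sq (by norm_num), ← inv_div (Real.pi * (d : ℝ)) 2, Real.sqrt_inv]
    ring
  rw [o, hs, setIntegral_const, smul_eq_mul, probReal_compl_eq_one_sub hR]
  linarith

/-! ### Two-sided bounds on the kernel -/

section Sandwich

variable {d : ℕ} {G : Type u} [Group G] [TopologicalSpace G] [MeasurableSpace G] [BorelSpace G]
  {ρ : G →* (E d ≃ₗᵢ[ℝ] E d)}

theorem integrable_norm_sub (hρ : Continuous (fun p : G × E d => ρ p.1 p.2)) (μ : Measure G)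
    [IsProbabilityMeasure μ] (x z : E d) :
    Integrable (fun p : G × G => ‖ρ p.1 x - ρ p.2 z‖) (μ.prod μ) := by
  refine Integrable.of_bound (C := ‖x‖ + ‖z‖) (Measurable.aestronglyMeasurable ?_)
    (ae_of_all _ fun p => ?_)
  · exact (((measurable_action_left hρ x).comp measurable_fst).sub
      ((measurable_action_left hρ z).comp measurable_snd)).norm
  · rw [norm_norm]
    simpa using norm_sub_le (ρ p.1 x) (ρ p.2 z)

variable [IsTopologicalGroup G] [CompactSpace G]

/-- Inverse invariance of `μ` in each variable removes the inverses left by the change of side,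
recovering the integral in `d_G`. -/
theorem integral_norm_inv_sub_inv (hρ : Continuous (fun p : G × E d => ρ p.1 p.2)) (μ : Measure G)
    [μ.IsHaarMeasure] [IsProbabilityMeasure μ] (x z : E d) :
    Integrable (fun p : G × G => ‖ρ p.1⁻¹ x - ρ p.2⁻¹ z‖) (μ.prod μ) ∧
    ∫ p, ‖ρ p.1⁻¹ x - ρ p.2⁻¹ z‖ ∂(μ.prod μ) = ∫ g, ∫ g', ‖ρ g x - ρ g' z‖ ∂μ ∂μ := by
  have := isInvInvariant_of_compactSpace μ
  have hi := integrable_norm_sub hρ μ x z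
  have mp : MeasurePreserving (fun p : G × G => (p.1⁻¹, p.2⁻¹)) (μ.prod μ) (μ.prod μ) :=
    (Measure.measurePreserving_inv μ).prod (Measure.measurePreserving_inv μ)
  have hi' : Integrable (fun p : G × G => ‖ρ p.1⁻¹ x - ρ p.2⁻¹ z‖) (μ.prod μ) :=
    mp.integrable_comp_of_integrable hi
  refine ⟨hi', ?_⟩
  rw [integral_prod _ hi', ← integral_inv_eq_self (fun g => ∫ g', ‖ρ g x - ρ g' z‖ ∂μ) μ]
  refine integral_congr_ae (ae_of_all _ fun g => ?_)
  exact integral_inv_eq_self (fun g' => ‖ρ g⁻¹ x - ρ g' z‖) μ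

theorem kernel_bounds (hρ : Continuous (fun p : G × E d => ρ p.1 p.2)) (μ : Measure G)
    [μ.IsHaarMeasure] [IsProbabilityMeasure μ] {ε : ℝ} (hε : 0 < ε) {x z : E d}
    (hx : ‖x‖ = 1) (hz : ‖z‖ = 1) :
    (1 + ε) - (1 + ε) * (gaussianLaw d).real (rejected d ε) - orbitDist ρ μ x z
      ≤ kernel ρ μ ε x z ∧
    kernel ρ μ ε x z ≤ (1 + ε) - (1 + ε) * (gaussianLaw d).real (rejected d ε)
      - orbitDist ρ μ x z + √((gaussianLaw d).real (rejected d ε)) / √d := by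
  set P := (gaussianLaw d).real (rejected d ε)
  obtain ⟨iF, hK⟩ := kernel_eq_integral_prod hρ μ hε hx hz
  obtain ⟨iN, hN⟩ := integral_norm_inv_sub_inv hρ μ x z
  simp_rw [setIntegral_sub_max_inner] at iF hK
  have base : ∀ c : ℝ, Integrable
      (fun p : G × G => c - 1 / √(2 * Real.pi * d) * ‖ρ p.1⁻¹ x - ρ p.2⁻¹ z‖) (μ.prod μ) :=
    fun c => (integrable_const c).sub (iN.const_mul _)
  have val : ∀ c : ℝ, ∫ p : G × G, (c - 1 / √(2 * Real.pi * d) * ‖ρ p.1⁻¹ x - ρ p.2⁻¹ z‖)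
      ∂(μ.prod μ) = c - orbitDist ρ μ x z := by
    intro c
    rw [integral_sub (integrable_const c) (iN.const_mul _), integral_const_mul, hN, orbitDist]
    simp
  constructor
  · rw [hK, ← val]
    refine integral_mono (base _) iF fun p => ?_
    have : 0 ≤ ∫ v in rejected d ε, |inner ℝ (ρ p.1⁻¹ x - ρ p.2⁻¹ z) v| ∂(gaussianLaw d) :=
      integral_nonneg fun v => abs_nonneg _
    simp only
    linarith
  · rw [hK, show ∀ a b c : ℝ, a - b + c = (a + c) - b by intros; ring, ← val]
    refine integral_mono iF (base _) fun p => ?_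
    have h := setIntegral_abs_inner_gaussianLaw_le (ρ p.1⁻¹ x - ρ p.2⁻¹ z)
      (measurableSet_rejected d ε)
    -- This 2 cancels the factor `1/2` in front of the rejected contribution.
    have h2 : ‖ρ p.1⁻¹ x - ρ p.2⁻¹ z‖ ≤ 2 := by
      have := norm_sub_le (ρ p.1⁻¹ x) (ρ p.2⁻¹ z)
      simp only [LinearIsometryEquiv.norm_map, hx, hz] at this
      linarith
    have h3 : ‖ρ p.1⁻¹ x - ρ p.2⁻¹ z‖ / √d * √P ≤ 2 * (√P / √d) := by
      rw [div_mul_eq_mul_div, mul_div_assoc]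
      gcongr
    simp only
    linarith

theorem kernel_sandwich (hρ : Continuous (fun p : G × E d => ρ p.1 p.2)) (μ : Measure G)
    [μ.IsHaarMeasure] [IsProbabilityMeasure μ] {ε : ℝ} (hε : ε ∈ Set.Ioo (0 : ℝ) 1) {x z : E d}
    (hx : ‖x‖ = 1) (hz : ‖z‖ = 1) :
    ε - delta2 d ε ≤ kernel ρ μ ε x z - (1 - orbitDist ρ μ x z) ∧
      kernel ρ μ ε x z - (1 - orbitDist ρ μ x z) ≤ ε + delta1 d ε := by
  obtain ⟨h0, h1⟩ := hε
  -- Dimension zero has no unit vectors.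
  have hd : d ≠ 0 := by
    rintro rfl
    rw [Subsingleton.elim x 0] at hx
    simp at hx
  obtain ⟨lo, hi⟩ := kernel_bounds hρ μ h0 hx hz
  set P := (gaussianLaw d).real (rejected d ε)
  set C := chernoff d ε
  have hP0 : 0 ≤ P := measureReal_nonneg
  have hPC : P ≤ C := gaussianLaw_rejected_le hd h0
  have hC1 : √C ≤ 1 := Real.sqrt_le_one.2 (chernoff_le_one d h0.le h1.le)
  have hCe := sqrt_chernoff_le d h0.le h1.le
  have hd1 : 1 ≤ √(d : ℝ) := Real.one_le_sqrt.2 (by exact_mod_cast Nat.one_le_iff_ne_zero.2 hd)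
  constructor
  · have : (1 + ε) * P ≤ (1 + ε) * Real.exp (-(d * ε ^ 2) / 8) := by
      gcongr
      exact hPC.trans (chernoff_le d h0.le h1.le)
    -- The lower bound loses only `(1 + ε) P`; this term of `delta2` is slack.
    have : 0 ≤ Real.exp (-(d * ε ^ 2) / 16) / √d := by positivity
    rw [delta2]
    linarith
  · have hq : √P ≤ √C := Real.sqrt_le_sqrt hPC
    have sP : √P ^ 2 = P := Real.sq_sqrt hP0
    have sC : √C ^ 2 = C := Real.sq_sqrt (hP0.trans hPC)
    -- The map `u ↦ u - u²/2` is increasing on `[0, 1]`, and `√P ≤ √C ≤ 1`. Bounding the two terms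
    -- separately would have the wrong sign for the negative one.
    have key : √P - P / 2 ≤ √C - C / 2 := by
      nlinarith [Real.sqrt_nonneg P]
    -- The negative term is weakened, using `1/2 ≤ 1 + ε` and `1 ≤ √d`, to obtain a function of `√P`
    -- that is monotone on `[0, 1]`.
    have e1 : √P / √d - (1 + ε) * P ≤ (√P - P / 2) / √d := by
      have : P / 2 / √d ≤ (1 + ε) * P := by
        refine (div_le_self (by positivity) hd1).trans ?_
        nlinarith
      rw [sub_div]
      linarith
    have e2 : (√P - P / 2) / √d ≤ (√C - C / 2) / √d := by gcongr
    have e3 : (√C - C / 2) / √d ≤ delta1 d ε := by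
      have : delta1 d ε = (Real.exp (-(d * ε ^ 2) / 16) - C / 2) / √d := by
        simp only [delta1, C, chernoff]; ring
      rw [this]
      gcongr
    linarith

end Sandwich

/-! ### Symmetry, invariance and positivity -/

section KernelProperties

variable {d : ℕ} {G : Type u} [Group G]

theorem kernel_comm [MeasurableSpace G] (ρ : G →* (E d ≃ₗᵢ[ℝ] E d)) (μ : Measure G) (ε : ℝ)
    (x z : E d) : kernel ρ μ ε x z = kernel ρ μ ε z x := by
  simp only [kernel, mul_comm]

variable [TopologicalSpace G] [MeasurableSpace G] [BorelSpace G] {ρ : G →* (E d ≃ₗᵢ[ℝ] E d)}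

/-- Acting on `x` by `h` replaces the set of group elements by its left translate, which has the
same measure. -/
theorem psi_action [IsTopologicalGroup G] (μ : Measure G) [μ.IsMulLeftInvariant] (h : G) (x : E d)
    (t : Option (E d)) (τ : ℝ) : psi ρ μ (ρ h x) t τ = psi ρ μ x t τ := by
  cases t with
  | none => rfl
  | some t =>
    simp only [psi, measureReal_def]
    rw [← measure_preimage_mul μ h⁻¹ {g : G | inner ℝ x (ρ g t) ≤ τ}]
    congr 2
    ext g
    have : inner ℝ (ρ h x) (ρ g t) = inner ℝ x (ρ (h⁻¹ * g) t) := by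
      rw [inner_action ρ g, inner_action ρ (h⁻¹ * g), mul_inv_rev, inv_inv, map_mul]
      rfl
    simp [this]

theorem kernel_action [IsTopologicalGroup G] (μ : Measure G) [μ.IsMulLeftInvariant] (ε : ℝ)
    (g g' : G) (x z : E d) : kernel ρ μ ε (ρ g x) (ρ g' z) = kernel ρ μ ε x z := by
  simp only [kernel, psi_action]

theorem integrable_psi_mul_psi (hρ : Continuous (fun p : G × E d => ρ p.1 p.2)) (μ : Measure G)
    [IsProbabilityMeasure μ] (ε : ℝ) (x z : E d) (ν : Measure (E d × ℝ)) [IsFiniteMeasure ν] :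
    Integrable (fun q : E d × ℝ =>
      psi ρ μ x (template ε q.1) q.2 * psi ρ μ z (template ε q.1) q.2) ν := by
  refine Integrable.of_bound (C := 1)
    ((measurable_psi hρ μ ε x).mul (measurable_psi hρ μ ε z)).aestronglyMeasurable
    (ae_of_all _ fun q => ?_)
  rw [Real.norm_of_nonneg (mul_nonneg (psi_nonneg ..) (psi_nonneg ..))]
  exact mul_le_one₀ (psi_le_one ..) (psi_nonneg ..) (psi_le_one ..)

theorem kernel_eq_integral_prod_volume (hρ : Continuous (fun p : G × E d => ρ p.1 p.2))
    (μ : Measure G) [IsProbabilityMeasure μ] {ε : ℝ} (hε : 0 ≤ 1 + ε) (x z : E d) :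
    kernel ρ μ ε x z = ∫ q, psi ρ μ x (template ε q.1) q.2 * psi ρ μ z (template ε q.1) q.2
      ∂((gaussianLaw d).prod (volume.restrict (Set.Ioc (-(1 + ε)) (1 + ε)))) := by
  rw [integral_prod _ (integrable_psi_mul_psi hρ μ ε x z _), kernel]
  simp_rw [intervalIntegral.integral_of_le (neg_le_self hε)]

/-- The kernel is an `L²` inner product of the functions `ψ(x, ·, ·)` over templates and thresholds,
so the quadratic form is the integral of a square. -/
theorem kernel_posSemidef (hρ : Continuous (fun p : G × E d => ρ p.1 p.2))
    (μ : Measure G) [IsProbabilityMeasure μ] {ε : ℝ} (hε : 0 ≤ 1 + ε) {N : ℕ} (x : Fin N → E d)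
    (c : Fin N → ℝ) : 0 ≤ ∑ i, ∑ j, c i * c j * kernel ρ μ ε (x i) (x j) := by
  have hi := fun i j => (integrable_psi_mul_psi hρ μ ε (x i) (x j)
    ((gaussianLaw d).prod (volume.restrict (Set.Ioc (-(1 + ε)) (1 + ε))))).const_mul (c i * c j)
  simp_rw [kernel_eq_integral_prod_volume hρ μ hε, ← integral_const_mul]
  simp_rw [← integral_finsetSum Finset.univ (fun j _ => hi _ j)]
  rw [← integral_finsetSum Finset.univ (fun i _ => integrable_finsetSum _ (fun j _ => hi i j))]
  refine integral_nonneg fun q => ?_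
  have : ∑ i, ∑ j, c i * c j * (psi ρ μ (x i) (template ε q.1) q.2
      * psi ρ μ (x j) (template ε q.1) q.2)
      = (∑ i, c i * psi ρ μ (x i) (template ε q.1) q.2) ^ 2 := by
    rw [sq, Finset.sum_mul_sum]
    exact Finset.sum_congr rfl fun i _ => Finset.sum_congr rfl fun j _ => by ring
  simp only [this]
  positivity

end KernelProperties

/-! ### Riemann sums of monotone functions -/

section RiemannSum

theorem sum_Icc_neg_eq_sum_range (n : ℕ) (F : ℝ → ℝ) :
    ∑ k ∈ Finset.Icc (-(n : ℤ)) n, F k = ∑ i ∈ Finset.range (2 * n + 1), F (-n + i) := by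
  symm
  refine Finset.sum_bij (fun i _ => (i : ℤ) - n) ?_ ?_ ?_ ?_
  · intro i hi
    simp only [Finset.mem_range, Finset.mem_Icc] at hi ⊢
    omega
  · intro i _ j _ h
    omega
  · intro k hk
    simp only [Finset.mem_range, Finset.mem_Icc] at hk ⊢
    exact ⟨(k + n).toNat, by omega, by omega⟩
  · intro i _
    push_cast
    congr 1
    ring

/-- Riemann sums of a monotone function with values in `[0, 1]`. -/
theorem abs_riemannSum_sub_integral_le {f : ℝ → ℝ} (hf : Monotone f) (h0 : ∀ τ, 0 ≤ f τ)
    (h1 : ∀ τ, f τ ≤ 1) {s : ℝ} (hs : 0 < s) {n : ℕ} (hn : 1 ≤ n) :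
    |s / n * ∑ k ∈ Finset.Icc (-(n : ℤ)) n, f (s * k / n) - ∫ τ in (-s)..s, f τ| ≤ 2 * s / n := by
  have hn' : (0 : ℝ) < n := by exact_mod_cast hn
  set F : ℝ → ℝ := fun y => f (s / n * y) with hF
  have hFm : Monotone F := fun a b hab => hf (by gcongr)
  have hsum : ∑ k ∈ Finset.Icc (-(n : ℤ)) n, f (s * k / n)
      = ∑ i ∈ Finset.range (2 * n + 1), F (-n + i) := by
    rw [← sum_Icc_neg_eq_sum_range]
    exact Finset.sum_congr rfl fun k _ => by simp only [hF]; congr 1; ring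
  have hint : ∫ τ in (-s)..s, f τ = s / n * ∫ y in (-n : ℝ)..(-n + (2 * n : ℕ)), F y := by
    have h2 : (-n : ℝ) + (2 * n : ℕ) = n := by push_cast; ring
    rw [h2, hF, intervalIntegral.mul_integral_comp_mul_left]
    congr 1 <;> field_simp
  -- The left and right sums over `2n` unit cells bracket the integral. The sum over `2n + 1` nodes
  -- exceeds the left one by the last value and the right one by the first, both in `[0, 1]`.
  have lo := (hFm.monotoneOn (Set.Icc (-n : ℝ) (-n + (2 * n : ℕ)))).sum_le_integral
  have hi := (hFm.monotoneOn (Set.Icc (-n : ℝ) (-n + (2 * n : ℕ)))).integral_le_sum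
  have e1 := Finset.sum_range_succ (fun i : ℕ => F (-n + i)) (2 * n)
  have e2 := Finset.sum_range_succ' (fun i : ℕ => F (-n + i)) (2 * n)
  have b1 : F (-n + (2 * n : ℕ)) ≤ 1 := h1 _
  have b2 : 0 ≤ F (-n + (0 : ℕ)) := h0 _
  rw [hsum, hint, ← mul_sub, abs_mul, abs_of_pos (by positivity : 0 < s / n)]
  rw [show 2 * s / n = s / n * 2 by ring]
  gcongr
  rw [abs_le]
  constructor <;> linarith

end RiemannSum

/-! ### Indicator expansion of the random features -/

section Features

variable {d : ℕ} {G : Type u} [Group G]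

open Classical in
/-- The indicator that the draw `v` is accepted and `⟨h v, x⟩ ≤ τ`. -/
noncomputable def belowIndicator (ρ : G →* (E d ≃ₗᵢ[ℝ] E d)) (ε τ : ℝ) (x : E d) (q : E d × G) :
    ℝ :=
  if ‖q.1‖ ^ 2 < 1 + ε ∧ inner ℝ x (ρ q.2 q.1) ≤ τ then 1 else 0

theorem belowIndicator_nonneg (ρ : G →* (E d ≃ₗᵢ[ℝ] E d)) (ε τ : ℝ) (x : E d) (q : E d × G) :
    0 ≤ belowIndicator ρ ε τ x q := by
  unfold belowIndicator; split_ifs <;> norm_num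

theorem belowIndicator_le_one (ρ : G →* (E d ≃ₗᵢ[ℝ] E d)) (ε τ : ℝ) (x : E d) (q : E d × G) :
    belowIndicator ρ ε τ x q ≤ 1 := by
  unfold belowIndicator; split_ifs <;> norm_num

theorem countBelow_template {r : ℕ} (ρ : G →* (E d ≃ₗᵢ[ℝ] E d)) (ε τ : ℝ) (x v : E d)
    (g : Fin r → G) :
    countBelow ρ g x (template ε v) τ = ∑ i, belowIndicator ρ ε τ x (v, g i) := by
  by_cases hv : ‖v‖ ^ 2 < 1 + ε
  · rw [template_of_lt hv]
    simp [countBelow, belowIndicator, hv, real_inner_comm]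
  · rw [template_of_not_lt hv]
    simp [countBelow, belowIndicator, hv]

theorem inner_featureMap {m r : ℕ} (n : ℕ) (ρ : G →* (E d ≃ₗᵢ[ℝ] E d)) {ε : ℝ} (hε : 0 ≤ 1 + ε)
    (v : Fin m → E d) (g : Fin r → G) (x z : E d) :
    inner ℝ (featureMap n ρ (1 + ε) (fun j => template ε (v j)) g x)
      (featureMap n ρ (1 + ε) (fun j => template ε (v j)) g z)
      = (1 + ε) / (n * m * r ^ 2) * ∑ j, ∑ k ∈ Finset.Icc (-(n : ℤ)) n, ∑ i, ∑ i',
          belowIndicator ρ ε ((1 + ε) * k / n) x (v j, g i)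
            * belowIndicator ρ ε ((1 + ε) * k / n) z (v j, g i') := by
  have hc : (√(1 + ε) / (√((n : ℝ) * m) * r)) ^ 2 = (1 + ε) / (n * m * r ^ 2) := by
    rw [div_pow, mul_pow, Real.sq_sqrt hε, Real.sq_sqrt (by positivity)]
  rw [PiLp.inner_apply, Fintype.sum_prod_type, Finset.mul_sum]
  refine Finset.sum_congr rfl fun j _ => ?_
  rw [← Finset.sum_coe_sort (Finset.Icc (-(n : ℤ)) n), Finset.mul_sum]
  refine Finset.sum_congr rfl fun k _ => ?_
  simp only [featureMap, countBelow_template, RCLike.inner_apply, conj_trivial]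
  rw [← hc, ← Finset.sum_mul_sum]
  ring

variable [TopologicalSpace G] [MeasurableSpace G] [BorelSpace G] {ρ : G →* (E d ≃ₗᵢ[ℝ] E d)}

theorem measurable_belowIndicator (hρ : Continuous (fun p : G × E d => ρ p.1 p.2)) (ε τ : ℝ)
    (x : E d) : Measurable (belowIndicator ρ ε τ x) := by
  classical
  have h1 : MeasurableSet {q : E d × G | ‖q.1‖ ^ 2 < 1 + ε} :=
    measurableSet_lt (by fun_prop) (by fun_prop)
  have h2 : MeasurableSet {q : E d × G | inner ℝ x (ρ q.2 q.1) ≤ τ} :=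
    measurableSet_le (measurable_inner_action hρ x measurable_fst measurable_snd) measurable_const
  exact Measurable.ite (h1.inter h2) measurable_const measurable_const

theorem integral_belowIndicator (hρ : Continuous (fun p : G × E d => ρ p.1 p.2)) (μ : Measure G)
    (ε τ : ℝ) (x v : E d) :
    ∫ g, belowIndicator ρ ε τ x (v, g) ∂μ = psi ρ μ x (template ε v) τ := by
  classical
  by_cases hv : ‖v‖ ^ 2 < 1 + ε
  · rw [template_of_lt hv]
    have : (fun g => belowIndicator ρ ε τ x (v, g))
        = {g : G | inner ℝ x (ρ g v) ≤ τ}.indicator 1 := by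
      ext g; simp [belowIndicator, hv, Set.indicator_apply]
    have hm : MeasurableSet {g : G | inner ℝ x (ρ g v) ≤ τ} := measurableSet_le
      (measurable_inner_action hρ x measurable_const measurable_id) measurable_const
    rw [this, integral_indicator_one hm]
    rfl
  · rw [template_of_not_lt hv]
    simp [belowIndicator, hv, psi]

theorem measurable_mul_belowIndicator (hρ : Continuous (fun p : G × E d => ρ p.1 p.2))
    (ε τ : ℝ) (x z : E d) {m r : ℕ} (j : Fin m) (i i' : Fin r) :
    Measurable (fun w : (Fin m → E d) × (Fin r → G) =>
      belowIndicator ρ ε τ x (w.1 j, w.2 i) * belowIndicator ρ ε τ z (w.1 j, w.2 i')) := by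
  have h : ∀ i, Measurable (fun w : (Fin m → E d) × (Fin r → G) => (w.1 j, w.2 i)) := fun i => by
    fun_prop
  exact ((measurable_belowIndicator hρ ε τ x).comp (h i)).mul
    ((measurable_belowIndicator hρ ε τ z).comp (h i'))

theorem integrable_mul_belowIndicator (hρ : Continuous (fun p : G × E d => ρ p.1 p.2))
    (ε τ : ℝ) (x z : E d) {m r : ℕ} (j : Fin m) (i i' : Fin r)
    (ν : Measure ((Fin m → E d) × (Fin r → G))) [IsFiniteMeasure ν] :
    Integrable (fun w : (Fin m → E d) × (Fin r → G) =>
      belowIndicator ρ ε τ x (w.1 j, w.2 i) * belowIndicator ρ ε τ z (w.1 j, w.2 i')) ν := by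
  refine Integrable.of_bound (C := 1)
    (measurable_mul_belowIndicator hρ ε τ x z j i i').aestronglyMeasurable (ae_of_all _ fun w => ?_)
  rw [Real.norm_of_nonneg (mul_nonneg (belowIndicator_nonneg ..) (belowIndicator_nonneg ..))]
  exact mul_le_one₀ (belowIndicator_le_one ..) (belowIndicator_nonneg ..)
    (belowIndicator_le_one ..)

theorem integral_eval_mul_eval {α : Type*} [MeasurableSpace α] (μ : Measure α)
    [IsProbabilityMeasure μ] {r : ℕ} {i i' : Fin r} (hi : i ≠ i') {f h : α → ℝ}
    (hf : Measurable f) (hh : Measurable h) :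
    ∫ g : Fin r → α, f (g i) * h (g i') ∂(Measure.pi fun _ => μ) = (∫ a, f a ∂μ) * ∫ a, h a ∂μ := by
  have hind : IndepFun (fun g : Fin r → α => g i) (fun g => g i') (Measure.pi fun _ => μ) :=
    (iIndepFun_pi (μ := fun _ : Fin r => μ) (X := fun _ g => g) (fun _ => aemeasurable_id)).indepFun
      hi
  rw [hind.integral_fun_comp_mul_comp (measurable_pi_apply i).aemeasurable
    (measurable_pi_apply i').aemeasurable hf.aestronglyMeasurable hh.aestronglyMeasurable,
    integral_comp_eval (μ := fun _ : Fin r => μ) (i := i) hf.aestronglyMeasurable,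
    integral_comp_eval (μ := fun _ : Fin r => μ) (i := i') hh.aestronglyMeasurable]

theorem measurable_psi_template (hρ : Continuous (fun p : G × E d => ρ p.1 p.2)) (μ : Measure G)
    [IsProbabilityMeasure μ] (ε τ : ℝ) (x : E d) :
    Measurable (fun v => psi ρ μ x (template ε v) τ) :=
  Measurable.of_uncurry_right (f := fun v τ => psi ρ μ x (template ε v) τ) (measurable_psi hρ μ ε x)

/-- Distinct group samples are independent, so their indicators decouple into `ψ`. -/
theorem integral_mul_belowIndicator_of_ne (hρ : Continuous (fun p : G × E d => ρ p.1 p.2))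
    (μ : Measure G) [IsProbabilityMeasure μ] (ε τ : ℝ) (x z : E d) {m r : ℕ} (j : Fin m)
    {i i' : Fin r} (hi : i ≠ i') :
    ∫ w : (Fin m → E d) × (Fin r → G),
      belowIndicator ρ ε τ x (w.1 j, w.2 i) * belowIndicator ρ ε τ z (w.1 j, w.2 i')
      ∂((Measure.pi fun _ : Fin m => gaussianLaw d).prod (Measure.pi fun _ : Fin r => μ))
    = ∫ v, psi ρ μ x (template ε v) τ * psi ρ μ z (template ε v) τ ∂(gaussianLaw d) := by
  rw [integral_prod _ (integrable_mul_belowIndicator hρ ε τ x z j i i' _)]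
  have mx : ∀ y v, Measurable fun g : G => belowIndicator ρ ε τ y (v, g) := fun y v =>
    Measurable.of_uncurry_left (f := fun v g => belowIndicator ρ ε τ y (v, g))
      (measurable_belowIndicator hρ ε τ y)
  simp_rw [fun v : Fin m → E d => integral_eval_mul_eval μ hi (mx x (v j)) (mx z (v j)),
    integral_belowIndicator hρ]
  exact integral_comp_eval (μ := fun _ : Fin m => gaussianLaw d)
    (f := fun v => psi ρ μ x (template ε v) τ * psi ρ μ z (template ε v) τ)
    ((measurable_psi_template hρ μ ε τ x).mul
      (measurable_psi_template hρ μ ε τ z)).aestronglyMeasurable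

end Features

/-! ### Convergence of the expected features to the kernel -/

section FeatureConvergence

variable {d : ℕ} {G : Type u} [Group G] [MeasurableSpace G]

theorem integral_psi_mul_psi_mem_Icc (ρ : G →* (E d ≃ₗᵢ[ℝ] E d)) (μ : Measure G)
    [IsProbabilityMeasure μ] (ε τ : ℝ) (x z : E d) :
    ∫ v, psi ρ μ x (template ε v) τ * psi ρ μ z (template ε v) τ ∂(gaussianLaw d)
      ∈ Set.Icc (0 : ℝ) 1 := by
  have h0 : ∀ v, 0 ≤ psi ρ μ x (template ε v) τ * psi ρ μ z (template ε v) τ :=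
    fun v => mul_nonneg (psi_nonneg ..) (psi_nonneg ..)
  refine ⟨integral_nonneg h0, ?_⟩
  have := integral_mono_of_nonneg (μ := gaussianLaw d) (ae_of_all _ h0)
    (integrable_const (1 : ℝ)) (ae_of_all _ fun v =>
      mul_le_one₀ (psi_le_one ρ μ x (template ε v) τ) (psi_nonneg ..)
        (psi_le_one ρ μ z (template ε v) τ))
  simpa using this

theorem integral_mul_belowIndicator_mem_Icc (ρ : G →* (E d ≃ₗᵢ[ℝ] E d))
    (ε τ : ℝ) (x z : E d) {m r : ℕ} (j : Fin m) (i i' : Fin r)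
    (ν : Measure ((Fin m → E d) × (Fin r → G))) [IsProbabilityMeasure ν] :
    ∫ w, belowIndicator ρ ε τ x (w.1 j, w.2 i) * belowIndicator ρ ε τ z (w.1 j, w.2 i') ∂ν
      ∈ Set.Icc (0 : ℝ) 1 := by
  have h0 : ∀ w : (Fin m → E d) × (Fin r → G), 0 ≤ belowIndicator ρ ε τ x (w.1 j, w.2 i)
      * belowIndicator ρ ε τ z (w.1 j, w.2 i') :=
    fun w => mul_nonneg (belowIndicator_nonneg ..) (belowIndicator_nonneg ..)
  refine ⟨integral_nonneg h0, ?_⟩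
  have := integral_mono_of_nonneg (μ := ν) (ae_of_all _ h0)
    (integrable_const (1 : ℝ)) (ae_of_all _ fun w =>
      mul_le_one₀ (belowIndicator_le_one ρ ε τ x (w.1 j, w.2 i)) (belowIndicator_nonneg ..)
        (belowIndicator_le_one ρ ε τ z (w.1 j, w.2 i')))
  simpa using this

variable [TopologicalSpace G] [BorelSpace G] {ρ : G →* (E d ≃ₗᵢ[ℝ] E d)}

theorem expectedFeatureInner_eq_sum (hρ : Continuous (fun p : G × E d => ρ p.1 p.2))
    (μ : Measure G) [IsProbabilityMeasure μ] {ε : ℝ} (hε : 0 ≤ 1 + ε) (x z : E d) (m n r : ℕ) :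
    expectedFeatureInner m n r ρ μ ε x z
      = (1 + ε) / (n * m * r ^ 2) * ∑ j : Fin m, ∑ k ∈ Finset.Icc (-(n : ℤ)) n,
        ∑ i : Fin r, ∑ i' : Fin r, ∫ w : (Fin m → E d) × (Fin r → G),
          belowIndicator ρ ε ((1 + ε) * k / n) x (w.1 j, w.2 i)
            * belowIndicator ρ ε ((1 + ε) * k / n) z (w.1 j, w.2 i')
          ∂((Measure.pi fun _ : Fin m => gaussianLaw d).prod (Measure.pi fun _ : Fin r => μ)) := by
  have hi := fun (j : Fin m) (k : ℤ) (i i' : Fin r) => integrable_mul_belowIndicator hρ ε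
    ((1 + ε) * k / n) x z j i i'
    ((Measure.pi fun _ : Fin m => gaussianLaw d).prod (Measure.pi fun _ : Fin r => μ))
  rw [expectedFeatureInner]
  simp_rw [inner_featureMap n ρ hε]
  rw [integral_const_mul, integral_finsetSum]
  swap
  · exact fun j _ => integrable_finsetSum _ fun k _ => integrable_finsetSum _ fun i _ =>
      integrable_finsetSum _ fun i' _ => hi j k i i'
  congr 1
  refine Finset.sum_congr rfl fun j _ => ?_
  rw [integral_finsetSum]
  swap
  · exact fun k _ => integrable_finsetSum _ fun i _ =>
      integrable_finsetSum _ fun i' _ => hi j k i i'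
  refine Finset.sum_congr rfl fun k _ => ?_
  rw [integral_finsetSum _ fun i _ => integrable_finsetSum _ fun i' _ => hi j k i i']
  exact Finset.sum_congr rfl fun i _ => integral_finsetSum _ fun i' _ => hi j k i i'

/-- The error made by sampling the group elements with repetition. -/
theorem abs_expectedFeatureInner_sub_le (hρ : Continuous (fun p : G × E d => ρ p.1 p.2))
    (μ : Measure G) [IsProbabilityMeasure μ] {ε : ℝ} (hε : 0 ≤ 1 + ε) (x z : E d) {m n r : ℕ}
    (hm : 1 ≤ m) (hn : 1 ≤ n) (hr : 1 ≤ r) :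
    |expectedFeatureInner m n r ρ μ ε x z
      - (1 + ε) / n * ∑ k ∈ Finset.Icc (-(n : ℤ)) n,
        ∫ v, psi ρ μ x (template ε v) ((1 + ε) * k / n)
          * psi ρ μ z (template ε v) ((1 + ε) * k / n) ∂(gaussianLaw d)| ≤ 3 * (1 + ε) / r := by
  have hm' : (1 : ℝ) ≤ m := by exact_mod_cast hm
  have hn' : (1 : ℝ) ≤ n := by exact_mod_cast hn
  have hr' : (1 : ℝ) ≤ r := by exact_mod_cast hr
  set A : ℤ → ℝ := fun k => ∫ v, psi ρ μ x (template ε v) ((1 + ε) * k / n)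
    * psi ρ μ z (template ε v) ((1 + ε) * k / n) ∂(gaussianLaw d) with hA
  set T : Fin m → ℤ → Fin r → Fin r → ℝ := fun j k i i' =>
    ∫ w : (Fin m → E d) × (Fin r → G),
      belowIndicator ρ ε ((1 + ε) * k / n) x (w.1 j, w.2 i)
        * belowIndicator ρ ε ((1 + ε) * k / n) z (w.1 j, w.2 i')
      ∂((Measure.pi fun _ : Fin m => gaussianLaw d).prod (Measure.pi fun _ : Fin r => μ)) with hT
  -- `A k` is repeated over all `j, i, i'` so that the two sums can be compared term by term.
  have hAT : (1 + ε) / n * ∑ k ∈ Finset.Icc (-(n : ℤ)) n, A k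
      = (1 + ε) / (n * m * r ^ 2) * ∑ _j : Fin m, ∑ k ∈ Finset.Icc (-(n : ℤ)) n,
        ∑ _i : Fin r, ∑ _i' : Fin r, A k := by
    simp only [Finset.sum_const, Finset.card_univ, Fintype.card_fin, nsmul_eq_mul,
      ← Finset.mul_sum]
    field_simp
  have hsplit : expectedFeatureInner m n r ρ μ ε x z
      - (1 + ε) / n * ∑ k ∈ Finset.Icc (-(n : ℤ)) n, A k
      = (1 + ε) / (n * m * r ^ 2) * ∑ j : Fin m, ∑ k ∈ Finset.Icc (-(n : ℤ)) n,
        ∑ i : Fin r, ∑ i' : Fin r, (T j k i i' - A k) := by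
    rw [hAT, expectedFeatureInner_eq_sum hρ μ hε, ← mul_sub]
    simp only [Finset.sum_sub_distrib, hT]
  -- Off-diagonal pairs are unbiased. On the diagonal both quantities lie in `[0, 1]`, and only `r`
  -- of the `r²` pairs are diagonal.
  have hterm : ∀ j k i i', |T j k i i' - A k| ≤ if i = i' then 1 else 0 := by
    intro j k i i'
    split_ifs with h
    · have a := integral_mul_belowIndicator_mem_Icc ρ ε ((1 + ε) * k / n) x z j i i'
        ((Measure.pi fun _ : Fin m => gaussianLaw d).prod (Measure.pi fun _ : Fin r => μ))
      have b := integral_psi_mul_psi_mem_Icc ρ μ ε ((1 + ε) * k / n) x z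
      simp only [hT, hA]
      exact abs_le.2 ⟨by linarith [a.1, b.2], by linarith [a.2, b.1]⟩
    · simp only [hT, hA]
      rw [integral_mul_belowIndicator_of_ne hρ μ ε _ x z j h, sub_self, abs_zero]
  have hsum : |∑ j : Fin m, ∑ k ∈ Finset.Icc (-(n : ℤ)) n,
      ∑ i : Fin r, ∑ i' : Fin r, (T j k i i' - A k)| ≤ m * ((2 * n + 1) * r) := by
    calc _ ≤ ∑ j : Fin m, ∑ k ∈ Finset.Icc (-(n : ℤ)) n,
        ∑ i : Fin r, ∑ i' : Fin r, |T j k i i' - A k| := by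
          refine (Finset.abs_sum_le_sum_abs _ _).trans (Finset.sum_le_sum fun j _ => ?_)
          refine (Finset.abs_sum_le_sum_abs _ _).trans (Finset.sum_le_sum fun k _ => ?_)
          refine (Finset.abs_sum_le_sum_abs _ _).trans (Finset.sum_le_sum fun i _ => ?_)
          exact Finset.abs_sum_le_sum_abs _ _
      _ ≤ ∑ j : Fin m, ∑ k ∈ Finset.Icc (-(n : ℤ)) n,
        ∑ i : Fin r, ∑ i' : Fin r, (if i = i' then 1 else 0) := by
          gcongr with j _ k _ i _ i' _
          exact hterm j k i i'
      _ = m * ((2 * n + 1) * r) := by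
          simp only [Finset.sum_ite_eq, Finset.mem_univ, if_true, Finset.sum_const,
            Finset.card_univ, Fintype.card_fin, nsmul_eq_mul, mul_one, Int.card_Icc]
          have : (n + 1 - -(n : ℤ)).toNat = 2 * n + 1 := by omega
          rw [this]
          push_cast
          ring
  rw [hsplit, abs_mul, abs_of_nonneg (by positivity)]
  calc _ ≤ (1 + ε) / (n * m * r ^ 2) * (m * ((2 * n + 1) * r)) := by gcongr
    _ = (1 + ε) * ((2 * n + 1) / n) / r := by field_simp
    _ ≤ (1 + ε) * 3 / r := by
      gcongr
      rw [div_le_iff₀ (by linarith)]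
      linarith
    _ = 3 * (1 + ε) / r := by ring

/-- The error made by replacing the integral over thresholds with a sum over bins. -/
theorem abs_sum_integral_psi_sub_kernel_le (hρ : Continuous (fun p : G × E d => ρ p.1 p.2))
    (μ : Measure G) [IsProbabilityMeasure μ] {ε : ℝ} (hε : 0 < 1 + ε) (x z : E d) {n : ℕ}
    (hn : 1 ≤ n) :
    |(1 + ε) / n * ∑ k ∈ Finset.Icc (-(n : ℤ)) n,
        ∫ v, psi ρ μ x (template ε v) ((1 + ε) * k / n)
          * psi ρ μ z (template ε v) ((1 + ε) * k / n) ∂(gaussianLaw d)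
      - kernel ρ μ ε x z| ≤ 2 * (1 + ε) / n := by
  have iA : ∀ τ, Integrable (fun v => psi ρ μ x (template ε v) τ * psi ρ μ z (template ε v) τ)
      (gaussianLaw d) := by
    intro τ
    refine Integrable.of_bound (C := 1) ((measurable_psi_template hρ μ ε τ x).mul
      (measurable_psi_template hρ μ ε τ z)).aestronglyMeasurable (ae_of_all _ fun v => ?_)
    rw [Real.norm_of_nonneg (mul_nonneg (psi_nonneg ..) (psi_nonneg ..))]
    exact mul_le_one₀ (psi_le_one ..) (psi_nonneg ..) (psi_le_one ..)
  have iK : Integrable (fun v => ∫ τ in (-(1 + ε))..(1 + ε),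
      psi ρ μ x (template ε v) τ * psi ρ μ z (template ε v) τ) (gaussianLaw d) := by
    simp_rw [intervalIntegral.integral_of_le (neg_le_self hε.le)]
    exact (integrable_psi_mul_psi hρ μ ε x z
      ((gaussianLaw d).prod (volume.restrict (Set.Ioc (-(1 + ε)) (1 + ε))))).integral_prod_left
  rw [kernel, ← integral_finsetSum _ (fun k _ => iA _), ← integral_const_mul, ← integral_sub
    ((integrable_finsetSum _ (fun k _ => iA _)).const_mul _) iK, ← Real.norm_eq_abs]
  refine (norm_integral_le_of_norm_le_const (C := 2 * (1 + ε) / n)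
    (ae_of_all _ fun v => ?_)).trans (by simp)
  -- The bound is uniform in the template, so it survives averaging. Monotonicity of the product
  -- uses that both CDFs are nonnegative.
  exact abs_riemannSum_sub_integral_le
    (f := fun τ => psi ρ μ x (template ε v) τ * psi ρ μ z (template ε v) τ)
    ((psi_monotone ρ μ x _).mul (psi_monotone ρ μ z _) (fun _ => psi_nonneg ..)
      (fun _ => psi_nonneg ..)) (fun _ => mul_nonneg (psi_nonneg ..) (psi_nonneg ..))
    (fun _ => mul_le_one₀ (psi_le_one ..) (psi_nonneg ..) (psi_le_one ..)) hε hn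

/-- The errors `3s/r` and `2s/n` each involve one index only, so the limit is joint, with no
prescribed order or relative rate. -/
theorem tendsto_expectedFeatureInner (hρ : Continuous (fun p : G × E d => ρ p.1 p.2))
    (μ : Measure G) [IsProbabilityMeasure μ] {ε : ℝ} (hε : 0 < 1 + ε) (x z : E d) {m : ℕ}
    (hm : 1 ≤ m) :
    Tendsto (fun p : ℕ × ℕ => expectedFeatureInner m p.1 p.2 ρ μ ε x z) (atTop ×ˢ atTop)
      (𝓝 (kernel ρ μ ε x z)) := by
  rw [tendsto_iff_dist_tendsto_zero]
  have hlim : Tendsto (fun p : ℕ × ℕ => 3 * (1 + ε) / (p.2 : ℝ) + 2 * (1 + ε) / (p.1 : ℝ))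
      (atTop ×ˢ atTop) (𝓝 0) := by
    have h1 := (tendsto_const_div_atTop_nhds_zero_nat (3 * (1 + ε))).comp
      (tendsto_snd (f := (atTop : Filter ℕ)) (g := (atTop : Filter ℕ)))
    have h2 := (tendsto_const_div_atTop_nhds_zero_nat (2 * (1 + ε))).comp
      (tendsto_fst (f := (atTop : Filter ℕ)) (g := (atTop : Filter ℕ)))
    simpa [Function.comp_def] using h1.add h2
  refine squeeze_zero' (Eventually.of_forall fun _ => dist_nonneg) ?_ hlim
  filter_upwards [(eventually_ge_atTop 1).prod_mk (eventually_ge_atTop 1)] with p hp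
  rw [Real.dist_eq]
  have a := abs_expectedFeatureInner_sub_le hρ μ hε.le x z hm hp.1 hp.2
  have b := abs_sum_integral_psi_sub_kernel_le hρ μ hε x z hp.1
  exact (abs_sub_le _ _ _).trans (add_le_add a b)

end FeatureConvergence

/-! ### Decay of the error terms -/

section ErrorTerms

theorem tendsto_exp_neg_mul_sq_div {ε c : ℝ} (hε : 0 < ε) (hc : 0 < c) :
    Tendsto (fun d : ℕ => Real.exp (-(d * ε ^ 2) / c)) atTop (𝓝 0) := by
  refine Real.tendsto_exp_neg_atTop_nhds_zero.comp (f := fun d : ℕ => d * ε ^ 2 / c) ?_ |>.congr ?_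
  · exact (tendsto_natCast_atTop_atTop.atTop_mul_const (by positivity)).atTop_div_const hc
  · intro d
    simp [neg_div]

theorem tendsto_div_sqrt_of_mem_Icc {f : ℕ → ℝ} (h0 : ∀ d, 0 ≤ f d) (h1 : ∀ d, f d ≤ 1) :
    Tendsto (fun d : ℕ => f d / √d) atTop (𝓝 0) := by
  have h : Tendsto (fun d : ℕ => 1 / √(d : ℝ)) atTop (𝓝 0) :=
    tendsto_const_nhds.div_atTop (Real.tendsto_sqrt_atTop.comp tendsto_natCast_atTop_atTop)
  refine squeeze_zero (fun d => div_nonneg (h0 d) (Real.sqrt_nonneg _)) (fun d => ?_) h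
  gcongr
  exact h1 d

theorem tendsto_exp_div_sqrt (ε : ℝ) :
    Tendsto (fun d : ℕ => Real.exp (-(d * ε ^ 2) / 16) / √d) atTop (𝓝 0) := by
  refine tendsto_div_sqrt_of_mem_Icc (fun d => (Real.exp_pos _).le) (fun d => ?_)
  have : (0 : ℝ) ≤ d * ε ^ 2 := by positivity
  exact Real.exp_le_one_iff.2 (by linarith)

theorem tendsto_delta1 {ε : ℝ} (hε : ε ∈ Set.Ioo (0 : ℝ) 1) :
    Tendsto (fun d : ℕ => delta1 d ε) atTop (𝓝 0) := by
  have h := (tendsto_exp_div_sqrt ε).sub ((tendsto_div_sqrt_of_mem_Icc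
    (fun d => (chernoff_pos d hε.1.le).le)
    (fun d => chernoff_le_one d hε.1.le hε.2.le)).const_mul (1 / 2))
  simpa [delta1, chernoff] using h

theorem tendsto_delta2 {ε : ℝ} (hε : 0 < ε) :
    Tendsto (fun d : ℕ => delta2 d ε) atTop (𝓝 0) := by
  have h := (tendsto_exp_div_sqrt ε).add
    ((tendsto_exp_neg_mul_sq_div hε (c := 8) (by norm_num)).const_mul (1 + ε))
  simpa [delta2] using h

end ErrorTerms

end CDFPool

/-! ### Main theorem -/

theorem theorem1 (ε : ℝ) (hε : ε ∈ Set.Ioo (0 : ℝ) 1) :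
    -- the statements about a fixed dimension and a fixed group
    (∀ (d : ℕ) (G : Type u) [Group G] [TopologicalSpace G] [IsTopologicalGroup G] [CompactSpace G]
        [MeasurableSpace G] [BorelSpace G]
        (μ : Measure G) [μ.IsHaarMeasure] [IsProbabilityMeasure μ]
        (ρ : G →* (CDFPool.E d ≃ₗᵢ[ℝ] CDFPool.E d)),
        Continuous (fun p : G × CDFPool.E d => ρ p.1 p.2) →
        -- for unit vectors: the random features induce the kernel, and the sandwich inequality
        (∀ x z : CDFPool.E d, ‖x‖ = 1 → ‖z‖ = 1 →
          (∀ m : ℕ, 1 ≤ m →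
            Tendsto (fun p : ℕ × ℕ => CDFPool.expectedFeatureInner m p.1 p.2 ρ μ ε x z)
              (atTop ×ˢ atTop) (𝓝 (CDFPool.kernel ρ μ ε x z))) ∧
          ε - CDFPool.delta2 d ε ≤
            CDFPool.kernel ρ μ ε x z - (1 - CDFPool.orbitDist ρ μ x z) ∧
          CDFPool.kernel ρ μ ε x z - (1 - CDFPool.orbitDist ρ μ x z) ≤
            ε + CDFPool.delta1 d ε) ∧
        -- symmetry
        (∀ x z : CDFPool.E d, CDFPool.kernel ρ μ ε x z = CDFPool.kernel ρ μ ε z x) ∧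
        -- positive semidefiniteness
        (∀ (N : ℕ) (x : Fin N → CDFPool.E d) (c : Fin N → ℝ),
          0 ≤ ∑ i, ∑ j, c i * c j * CDFPool.kernel ρ μ ε (x i) (x j)) ∧
        -- group invariance
        (∀ (g g' : G) (x z : CDFPool.E d),
          CDFPool.kernel ρ μ ε (ρ g x) (ρ g' z) = CDFPool.kernel ρ μ ε x z)) ∧
    -- the error terms vanish as the dimension grows
    Tendsto (fun d : ℕ => CDFPool.delta1 d ε) atTop (𝓝 0) ∧
    Tendsto (fun d : ℕ => CDFPool.delta2 d ε) atTop (𝓝 0) ∧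
    -- `K_s - (s - d_G) → 0` as `d → ∞`, uniformly over all groups and all pairs of unit vectors
    (∀ η : ℝ, 0 < η → ∃ D : ℕ, ∀ d : ℕ, D ≤ d →
      ∀ (G : Type u) [Group G] [TopologicalSpace G] [IsTopologicalGroup G] [CompactSpace G]
        [MeasurableSpace G] [BorelSpace G]
        (μ : Measure G) [μ.IsHaarMeasure] [IsProbabilityMeasure μ]
        (ρ : G →* (CDFPool.E d ≃ₗᵢ[ℝ] CDFPool.E d)),
        Continuous (fun p : G × CDFPool.E d => ρ p.1 p.2) →
        ∀ x z : CDFPool.E d, ‖x‖ = 1 → ‖z‖ = 1 →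
          |CDFPool.kernel ρ μ ε x z - ((1 + ε) - CDFPool.orbitDist ρ μ x z)| < η) := by
  refine ⟨?_, CDFPool.tendsto_delta1 hε, CDFPool.tendsto_delta2 hε.1, ?_⟩
  · intro d G _ _ _ _ _ _ μ _ _ ρ hρ
    have hs : 0 < 1 + ε := by linarith [hε.1]
    refine ⟨fun x z hx hz => ⟨fun m hm => CDFPool.tendsto_expectedFeatureInner hρ μ hs x z hm,
      CDFPool.kernel_sandwich hρ μ hε hx hz⟩, CDFPool.kernel_comm ρ μ ε,
      fun N x c => CDFPool.kernel_posSemidef hρ μ hs.le x c, CDFPool.kernel_action μ ε⟩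
  · intro η hη
    have h1 := (CDFPool.tendsto_delta1 hε).eventually (gt_mem_nhds hη)
    have h2 := (CDFPool.tendsto_delta2 hε.1).eventually (gt_mem_nhds hη)
    -- The error terms depend on `d` and `ε` alone, so `D` is chosen before the group and the
    -- vectors; this is the uniformity.
    obtain ⟨D, hD⟩ := eventually_atTop.1 (h1.and h2)
    refine ⟨D, fun d hd G _ _ _ _ _ _ μ _ _ ρ hρ x z hx hz => ?_⟩
    obtain ⟨lo, hi⟩ := CDFPool.kernel_sandwich hρ μ hε hx hz
    obtain ⟨b1, b2⟩ := hD d hd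
    rw [abs_lt]
    constructor <;> linarith
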